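/- Let $H$ be a complex Hilbert space, let $X=(X_1,\dots,X_m)$ be a scalar or vector quantity, i.e. linear operators $X_j:D\to H$ on a common dense domain $D\subseteq H$ such that $X:D\to H^m$, $\psi\mapsto(X_1\psi,\dots,X_m\psi)$, is closable (equivalently, $X^*$ is densely defined), and let $\xi\in\mathbb C^m$. Let $|X-\xi|^2:=(X-\xi)^*(X-\xi)$ denote the positive self-adjoint operator $T^*T$ in $H$ with its natural domain $\{\psi\in\operatorname{dom}T: T\psi\in\operatorname{dom}T^*\}$, where $T$ is the closure of $X-\xi:D\to H^m$. The spectrum $\operatorname{Spec}X$ is the set of $\xi\in\mathbb C^m$ for which there is no bounded linear operator $R:H\to H$ with $R\,|X-\xi|^2\psi=\psi$ for all $\psi\in\operatorname{dom}|X-\xi|^2$. A state is given by a density operator $\rho$ (a positive semidefinite operator of trace $1$). The q-expectation $\langle B\rangle=\operatorname{Tr}\rho B$ of a densely defined operator $B$ is defined in this state if $\rho B$ extends to a bounded trace class operator, and is then the trace of this extension. Theorem. (i) $\xi\in\operatorname{Spec}X$ if and only if for every $\varepsilon>0$ there is a state in which $\langle|X-\xi|^2\rangle$ is defined and $0\le\langle|X-\xi|^2\rangle<\varepsilon$.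 (ii) If $X_j\psi\neq\xi_j\psi$ for some $j$ and some $\psi\in D$ (that is, $X$ is not the constant $\xi$), then $\xi\in\operatorname{Spec}X$ if and only if for every $\varepsilon>0$ there is a state in which $\langle|X-\xi|^2\rangle$ is defined and $0<\langle|X-\xi|^2\rangle<\varepsilon$. -/

import Mathlib

universe u

namespace ThermalInterpretation

noncomputable section

variable {H : Type u} [NormedAddCommGroup H] [InnerProductSpace ℂ H]

/-- A vector `X = (X₁, …, X_m)` of operators on the common domain `D`, regarded as one partially
defined operator `ψ ↦ (X₁ ψ, …, X_m ψ)` from `H` to the Hilbert sum `H ⊕ ⋯ ⊕ H`. -/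
def vectorOperator {m : ℕ} (D : Submodule ℂ H) (X : Fin m → D →ₗ[ℂ] H) :
    H →ₗ.[ℂ] PiLp 2 (fun _ : Fin m => H) where
  domain := D
  toFun := (WithLp.linearEquiv 2 ℂ (Fin m → H)).symm.toLinearMap ∘ₗ LinearMap.pi X

/-- The vector quantity `X - ξ` with components `X_j - ξ_j` on the same domain. -/
def shift {m : ℕ} {D : Submodule ℂ H} (X : Fin m → D →ₗ[ℂ] H) (ξ : Fin m → ℂ) :
    Fin m → D →ₗ[ℂ] H :=
  fun j => X j - ξ j • D.subtype

variable [CompleteSpace H]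

/-- The operator `T* T` of a partially defined operator `T` between Hilbert spaces, with its natural
domain `{ψ ∈ dom T | T ψ ∈ dom T*}`. -/
def adjointMulSelf {K : Type*} [NormedAddCommGroup K] [InnerProductSpace ℂ K]
    (T : H →ₗ.[ℂ] K) : H →ₗ.[ℂ] H where
  domain := (T.adjoint.domain.comap T.toFun).map T.domain.subtype
  toFun := T.adjoint.toFun ∘ₗ
    LinearMap.codRestrict T.adjoint.domain
      (T.toFun ∘ₗ Submodule.inclusion (Submodule.map_subtype_le T.domain _))
      (by
        rintro ⟨_, ⟨x, hx, rfl⟩⟩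
        exact hx)

/-- The positive self-adjoint operator `|Y|² = Y* Y` of a closable vector quantity `Y`:
it is `T* T`, where `T` is the closure of the operator `Y` from `H` to `H ⊕ ⋯ ⊕ H`. -/
def absSq {m : ℕ} (D : Submodule ℂ H) (Y : Fin m → D →ₗ[ℂ] H) : H →ₗ.[ℂ] H :=
  adjointMulSelf (vectorOperator D Y).closure

/-- The spectrum of a vector quantity `X`: the set of all `ξ ∈ ℂ^m` such that no (bounded,
everywhere defined) linear operator `R` satisfies `R |X - ξ|² = 1`. -/
def spec {m : ℕ} (D : Submodule ℂ H) (X : Fin m → D →ₗ[ℂ] H) : Set (Fin m → ℂ) :=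
  {ξ | ¬ ∃ R : H →L[ℂ] H,
    ∀ ψ : (absSq D (shift X ξ)).domain, R (absSq D (shift X ξ) ψ) = (ψ : H)}

/-- The bounded operator `A` is of trace class with trace `t`: the sum `∑ᵢ ⟨eᵢ, A eᵢ⟩` converges
unconditionally to `t` for every orthonormal basis `(eᵢ)`. -/
def HasTrace (A : H →L[ℂ] H) (t : ℂ) : Prop :=
  ∀ (ι : Type u) (e : HilbertBasis ι ℂ H), HasSum (fun i => inner ℂ (e i) (A (e i))) t

/-- A (normalized) state, given by its density operator: a positive semidefinite Hermitian operator
of trace one. -/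
structure State (H : Type u) [NormedAddCommGroup H] [InnerProductSpace ℂ H] [CompleteSpace H] where
  density : H →L[ℂ] H
  isPositive : density.IsPositive
  hasTrace_one : HasTrace density 1

/-- In the state with density operator `ρ` the q-expectation `⟨B⟩ = Tr ρB` of the densely defined
operator `B` exists and equals `t`: the operator `ρB` on `dom B` extends to a (by density unique)
bounded operator of trace class, with trace `t`. -/
def State.HasQExpectation (ρ : State H) (B : H →ₗ.[ℂ] H) (t : ℂ) : Prop :=
  ∃ A : H →L[ℂ] H, (∀ ψ : B.domain, A ψ = ρ.density (B ψ)) ∧ HasTrace A t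

end

end ThermalInterpretation

/-! Write `B = T* T` for the closed densely defined `T`. Both parts rest on one dichotomy: `B` has a
bounded left inverse exactly when its quadratic form is bounded below by a positive multiple of
`‖ψ‖²`, and the q-expectations of `B` are weighted averages of that form.

If `R B = 1` on `dom B`, self-adjointness of `B` makes `B` onto, so `R` is positive and
Cauchy–Schwarz for `R` gives `‖ψ‖² ≤ ‖R‖ ⟨Bψ, ψ⟩` (`norm_sq_le_of_leftInverse`). A density operator
`ρ` is compact, hence diagonal in an orthonormal basis `b i` with weights `p i`. Boundedness of `ρB`
forces `b i ∈ dom B` whenever `p i ≠ 0`, so `Tr ρB = ∑ p i ⟨b i, B b i⟩` and `1 ≤ ‖R‖ Tr ρB`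
(`one_le_norm_mul_of_hasQExpectation`).

If no `R` exists, `B` is not bounded below, and normalized vectors with small Rayleigh quotient give
pure states with small expectation. For a strictly positive expectation, a vector in the kernel of
`T` is perturbed slightly out of it. -/

/-! ### Positive, Hilbert–Schmidt and compact operators -/

/-- Cauchy–Schwarz for the form of a positive operator. -/
theorem ContinuousLinearMap.IsPositive.norm_sq_apply_le {H : Type*} [NormedAddCommGroup H]
    [InnerProductSpace ℂ H] {R : H →L[ℂ] H} (hR : R.IsPositive) (x : H) :
    ‖R x‖ ^ 2 ≤ ‖R‖ * (inner ℂ (R x) x).re := by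
  rcases eq_or_ne R 0 with rfl | h0
  · simp
  have hpos : 0 < ‖R‖ := norm_pos_iff.mpr h0
  have hs : ∀ a b, inner ℂ (R a) b = inner ℂ a (R b) := hR.isSymmetric
  have key : ∀ s : ℝ, 0 ≤ (inner ℂ (R x) x).re - 2 * s * ‖R x‖ ^ 2
      + s ^ 2 * (inner ℂ (R (R x)) (R x)).re := by
    intro s
    have h := hR.re_inner_nonneg_left (x - (s : ℂ) • R x)
    have h1 : (inner ℂ (R x) (R x) : ℂ).re = ‖R x‖ ^ 2 := by
      rw [inner_self_eq_norm_sq_to_K]; norm_cast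
    have h2 : (inner ℂ (R (R x)) x : ℂ).re = ‖R x‖ ^ 2 := by rw [hs, h1]
    simp only [map_sub, map_smul, inner_sub_left, inner_sub_right, inner_smul_left,
      inner_smul_right, Complex.conj_ofReal, RCLike.re_to_complex, Complex.sub_re,
      Complex.re_ofReal_mul, h1, h2] at h
    linarith
  have hb : (inner ℂ (R (R x)) (R x)).re ≤ ‖R‖ * ‖R x‖ ^ 2 := by
    calc (inner ℂ (R (R x)) (R x)).re ≤ ‖R (R x)‖ * ‖R x‖ := re_inner_le_norm (𝕜 := ℂ) _ _
      _ ≤ (‖R‖ * ‖R x‖) * ‖R x‖ := by gcongr; exact R.le_opNorm _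
      _ = _ := by ring
  -- For this `s` the quadratic term is at most half the size of the linear one.
  have h := key ‖R‖⁻¹
  have h3 : ‖R‖⁻¹ ^ 2 * (inner ℂ (R (R x)) (R x)).re ≤ ‖R‖⁻¹ * ‖R x‖ ^ 2 := by
    calc _ ≤ ‖R‖⁻¹ ^ 2 * (‖R‖ * ‖R x‖ ^ 2) := by gcongr
      _ = _ := by field_simp
  have h4 : ‖R‖⁻¹ * ‖R x‖ ^ 2 ≤ (inner ℂ (R x) x).re := by linarith
  rwa [inv_mul_le_iff₀ hpos] at h4

/-- Parseval's identity. -/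
theorem HilbertBasis.hasSum_norm_inner_sq {ι 𝕜 E : Type*} [RCLike 𝕜] [NormedAddCommGroup E]
    [InnerProductSpace 𝕜 E] (b : HilbertBasis ι 𝕜 E) (x : E) :
    HasSum (fun i => ‖inner 𝕜 (b i) x‖ ^ 2) (‖x‖ ^ 2) := by
  have h := RCLike.hasSum_re 𝕜 (b.hasSum_inner_mul_inner x x)
  rw [inner_self_eq_norm_sq] at h
  convert h using 2 with i
  rw [inner_mul_symm_re_eq_norm, norm_mul, norm_inner_symm, sq]

/-- A Hilbert–Schmidt operator is compact. -/
theorem HilbertBasis.isCompactOperator_of_summable {ι 𝕜 E : Type*} [RCLike 𝕜]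
    [NormedAddCommGroup E] [InnerProductSpace 𝕜 E] [CompleteSpace E] (b : HilbertBasis ι 𝕜 E)
    (T : E →L[𝕜] E) (hT : T.IsSymmetric) (hs : Summable fun i => ‖T (b i)‖ ^ 2) :
    IsCompactOperator T := by
  classical
  -- By symmetry `P s y` is the projection of `T y` onto the span of the `b i` with `i ∈ s`. By
  -- Parseval and Cauchy–Schwarz, `‖P s - T‖²` is at most the tail of `∑ ‖T (b i)‖²`, so `T` is a
  -- norm limit of finite-rank operators.
  let P : Finset ι → E →L[𝕜] E := fun s => ∑ i ∈ s, InnerProductSpace.rankOne 𝕜 (b i) (T (b i))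
  have hP : ∀ s y, P s y = ∑ i ∈ s, inner 𝕜 (T (b i)) y • b i := fun s y => by simp [P]
  have hlim : Filter.Tendsto P Filter.atTop (nhds T) := by
    rw [tendsto_iff_norm_sub_tendsto_zero]
    have h0 := (tendsto_tsum_compl_atTop_zero fun i => ‖T (b i)‖ ^ 2).sqrt
    rw [Real.sqrt_zero] at h0
    refine squeeze_zero (fun _ => norm_nonneg _) (fun s => ?_) h0
    refine ContinuousLinearMap.opNorm_le_bound _ (Real.sqrt_nonneg _) fun y => ?_
    have hc : ∀ i, inner 𝕜 (b i) ((P s - T) y) = if i ∈ s then 0 else -inner 𝕜 (T (b i)) y := by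
      intro i
      have : inner 𝕜 (T (b i)) y = inner 𝕜 (b i) (T y) := hT _ _
      rw [sub_apply, inner_sub_right, hP, inner_sum, ← this]
      simp only [inner_smul_right, orthonormal_iff_ite.mp b.orthonormal i]
      split_ifs with h <;> simp [h]
    have hsum := b.hasSum_norm_inner_sq ((P s - T) y)
    have hsub : Summable fun i : {x // x ∉ s} => ‖T (b i)‖ ^ 2 :=
      hs.subtype {x | x ∉ s}
    have hle : ‖(P s - T) y‖ ^ 2 ≤ (∑' i : {x // x ∉ s}, ‖T (b i)‖ ^ 2) * ‖y‖ ^ 2 := by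
      have hi : HasSum (fun i : {x // x ∉ s} => ‖inner 𝕜 (b i) ((P s - T) y)‖ ^ 2)
          (‖(P s - T) y‖ ^ 2) := by
        refine (hasSum_subtype_iff_of_support_subset (s := {x | x ∉ s}) ?_).mpr hsum
        intro i hi h
        have h' : i ∈ s := by simpa using h
        exact hi (by simp only [hc, if_pos h', norm_zero]; simp)
      refine hasSum_le (fun i => ?_) hi (hsub.hasSum.mul_right _)
      rw [hc, if_neg i.2, norm_neg, ← mul_pow]
      gcongr
      exact norm_inner_le_norm _ _
    rw [← Real.sqrt_sq (norm_nonneg ((P s - T) y))]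
    calc _ ≤ √((∑' i : {x // x ∉ s}, ‖T (b i)‖ ^ 2) * ‖y‖ ^ 2) := Real.sqrt_le_sqrt hle
      _ = _ := by rw [Real.sqrt_mul (tsum_nonneg fun _ => by positivity),
                    Real.sqrt_sq (norm_nonneg _)]
  refine isCompactOperator_of_tendsto hlim (Filter.Eventually.of_forall fun s => ?_)
  refine (compactOperator (RingHom.id 𝕜) E E).sum_mem fun i _ => ?_
  exact (isCompactOperator_of_locallyCompactSpace_dom (innerSL 𝕜 (T (b i)))).clm_comp
    (ContinuousLinearMap.toSpanSingleton 𝕜 (b i))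

/-- A compact self-adjoint operator has an orthonormal basis of eigenvectors. -/
theorem ContinuousLinearMap.exists_hilbertBasis_eigenvectors {H : Type u} [NormedAddCommGroup H]
    [InnerProductSpace ℂ H] [CompleteSpace H] {T : H →L[ℂ] H} (hT : IsCompactOperator T)
    (hT' : T.IsSymmetric) :
    ∃ (ι : Type u) (b : HilbertBasis ι ℂ H) (p : ι → ℂ), ∀ i, T (b i) = p i • b i := by
  let G : ℂ → Submodule ℂ H := fun μ => Module.End.eigenspace (T : Module.End ℂ H) μ
  have hG : ∀ μ, CompleteSpace (G μ) := fun μ => by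
    have : IsClosed (G μ : Set H) := by
      have : (G μ : Set H) = {x | T x = μ • x} := by
        ext x; exact Module.End.mem_eigenspace_iff
      rw [this]
      exact isClosed_eq T.continuous (continuous_const_smul μ)
    exact this.completeSpace_coe
  -- Here `μ` runs over all of `ℂ`: a trivial eigenspace contributes the empty basis, and `μ = 0`
  -- contributes the kernel.
  choose w b hb using fun μ => exists_hilbertBasis ℂ (G μ)
  have ho := (LinearMap.IsSymmetric.orthogonalFamily_eigenspaces hT').orthonormal_sigma_orthonormal
    (fun μ => (b μ).orthonormal)
  have hbot : (Submodule.span ℂ (Set.range fun a : Σ μ, w μ => ((b a.1 a.2 : G a.1) : H)))ᗮ = ⊥ := by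
    rw [← ContinuousLinearMap.orthogonalComplement_iSup_eigenspaces_eq_bot hT hT', eq_comm]
    refine le_antisymm (Submodule.orthogonal_le ?_) ?_
    · rw [Submodule.span_le]
      rintro _ ⟨a, rfl⟩
      exact Submodule.mem_iSup_of_mem a.1 (b a.1 a.2).2
    · intro x hx
      rw [← Submodule.iInf_orthogonal, Submodule.mem_iInf]
      intro μ v hv
      have h := ((b μ).hasSum_repr ⟨v, hv⟩).mapL ((innerSL ℂ x).comp (G μ).subtypeL)
      have h0 : ∀ i, inner ℂ x ((b μ i : G μ) : H) = 0 := fun i => by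
        rw [← inner_conj_symm, hx _ (Submodule.subset_span ⟨⟨μ, i⟩, rfl⟩), map_zero]
      simp only [map_smul, ContinuousLinearMap.comp_apply, Submodule.subtypeL_apply,
        innerSL_apply_apply, h0, smul_zero] at h
      rw [← inner_conj_symm, h.unique hasSum_zero, map_zero]
  refine ⟨Σ μ, w μ, HilbertBasis.mkOfOrthogonalEqBot ho hbot, fun a => a.1, fun a => ?_⟩
  have hcoe := congrFun (HilbertBasis.coe_mkOfOrthogonalEqBot ho hbot) a
  rw [hcoe]
  exact Module.End.mem_eigenspace_iff.mp (b a.1 a.2).2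
-- Von Neumann's theorem on `T* T` and its bounded left inverses
namespace ThermalInterpretation

section AdjointMulSelf

variable {H K : Type*} [NormedAddCommGroup H] [InnerProductSpace ℂ H] [CompleteSpace H]
  [NormedAddCommGroup K] [InnerProductSpace ℂ K] {T : H →ₗ.[ℂ] K}

theorem mem_adjointMulSelf_domain_iff {x : H} :
    x ∈ (adjointMulSelf T).domain ↔ ∃ h : x ∈ T.domain, T ⟨x, h⟩ ∈ T.adjoint.domain := by
  constructor
  · rintro ⟨y, hy, rfl⟩
    exact ⟨y.2, hy⟩
  · rintro ⟨h, h'⟩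
    exact ⟨⟨x, h⟩, h', rfl⟩

theorem adjointMulSelf_domain_le : (adjointMulSelf T).domain ≤ T.domain :=
  Submodule.map_subtype_le _ _

theorem inner_adjointMulSelf (hT : Dense (T.domain : Set H)) (ψ : (adjointMulSelf T).domain)
    (φ : T.domain) :
    inner ℂ (adjointMulSelf T ψ) (φ : H) = inner ℂ (T ⟨ψ, adjointMulSelf_domain_le ψ.2⟩) (T φ) := by
  obtain ⟨h, h'⟩ := mem_adjointMulSelf_domain_iff.mp ψ.2
  exact T.adjoint_isFormalAdjoint hT ⟨T ⟨ψ, h⟩, h'⟩ φ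

theorem inner_adjointMulSelf_symm (hT : Dense (T.domain : Set H))
    (ψ φ : (adjointMulSelf T).domain) :
    inner ℂ (adjointMulSelf T ψ) (φ : H) = inner ℂ (ψ : H) (adjointMulSelf T φ) := by
  rw [inner_adjointMulSelf hT ψ ⟨φ, adjointMulSelf_domain_le φ.2⟩, ← inner_conj_symm (ψ : H),
    inner_adjointMulSelf hT φ ⟨ψ, adjointMulSelf_domain_le ψ.2⟩, inner_conj_symm]

theorem re_inner_adjointMulSelf_self (hT : Dense (T.domain : Set H))
    (ψ : (adjointMulSelf T).domain) :
    (inner ℂ (adjointMulSelf T ψ) (ψ : H)).re = ‖T ⟨ψ, adjointMulSelf_domain_le ψ.2⟩‖ ^ 2 := by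
  rw [inner_adjointMulSelf hT ψ ⟨ψ, adjointMulSelf_domain_le ψ.2⟩]
  exact (norm_sq_eq_re_inner (𝕜 := ℂ) _).symm

/-- von Neumann: `1 + T* T` is onto when `T` is closed and densely defined. -/
theorem exists_add_adjointMulSelf_eq [CompleteSpace K] (hT : Dense (T.domain : Set H))
    (hc : T.IsClosed) (y : H) :
    ∃ ψ : (adjointMulSelf T).domain, (ψ : H) + adjointMulSelf T ψ = y := by
  let Γ : Submodule ℂ (WithLp 2 (H × K)) :=
    T.graph.comap (WithLp.prodContinuousLinearEquiv 2 ℂ H K).toLinearEquiv.toLinearMap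
  have hΓ : IsClosed (Γ : Set (WithLp 2 (H × K))) :=
    IsClosed.preimage (WithLp.prodContinuousLinearEquiv 2 ℂ H K).continuous hc
  have : CompleteSpace Γ := hΓ.completeSpace_coe
  -- Project `(y, 0)` onto the graph: `(y, 0) = (x, T x) + z`. Orthogonality of `z` to the graph
  -- says that `T x = -z.snd` lies in `dom T*` with `T* T x = z.fst`, and the first coordinates add
  -- up to `y`.
  obtain ⟨g, hg, z, hz, hgz⟩ :=
    Submodule.exists_add_mem_mem_orthogonal (K := Γ) (WithLp.toLp 2 ((y, 0) : H × K))
  obtain ⟨x, hx1, hx2⟩ := (T.mem_graph_iff).mp hg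
  have hz' : ∀ φ : T.domain, inner ℂ (-z.fst) (φ : H) = inner ℂ z.snd (T φ) := by
    intro φ
    have h := hz (WithLp.toLp 2 ((φ : H), T φ)) (T.mem_graph φ)
    rw [← inner_conj_symm, WithLp.prod_inner_apply, map_eq_zero] at h
    rw [inner_neg_left]
    exact neg_eq_of_add_eq_zero_right h
  have e1 : y = g.fst + z.fst := congrArg WithLp.fst hgz
  have e2 : 0 = g.snd + z.snd := congrArg WithLp.snd hgz
  have hx1' : (x : H) = g.fst := hx1
  have hx2' : T x = g.snd := hx2
  have hTx : T x = -z.snd := by rw [hx2']; exact eq_neg_of_add_eq_zero_left e2.symm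
  have hz2 : ∀ φ : T.domain, inner ℂ z.fst (φ : H) = inner ℂ (T x) (T φ) := fun φ => by
    rw [hTx, inner_neg_left, ← hz' φ, inner_neg_left, neg_neg]
  have hmem : T x ∈ T.adjoint.domain := T.mem_adjoint_domain_of_exists _ ⟨z.fst, hz2⟩
  refine ⟨⟨x, mem_adjointMulSelf_domain_iff.mpr ⟨x.2, hmem⟩⟩, ?_⟩
  have : adjointMulSelf T ⟨x, mem_adjointMulSelf_domain_iff.mpr ⟨x.2, hmem⟩⟩ = z.fst :=
    LinearPMap.adjoint_apply_eq hT ⟨T x, hmem⟩ hz2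
  rw [this, hx1', e1]

/-- A vector orthogonal to the domain has the form `ψ + T* T ψ`; pairing it with `ψ` gives `‖ψ‖² +
‖T ψ‖² = 0`. -/
theorem dense_adjointMulSelf_domain [CompleteSpace K] (hT : Dense (T.domain : Set H))
    (hc : T.IsClosed) : Dense ((adjointMulSelf T).domain : Set H) := by
  rw [Submodule.dense_iff_topologicalClosure_eq_top, Submodule.topologicalClosure_eq_top_iff,
    Submodule.eq_bot_iff]
  intro x hx
  obtain ⟨ψ, rfl⟩ := exists_add_adjointMulSelf_eq hT hc x
  have h : (inner ℂ (ψ : H) ((ψ : H) + adjointMulSelf T ψ)).re = 0 := by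
    rw [hx ψ ψ.2, Complex.zero_re]
  rw [inner_add_right, ← inner_adjointMulSelf_symm hT, Complex.add_re,
    re_inner_adjointMulSelf_self hT] at h
  have h1 : (inner ℂ (ψ : H) (ψ : H)).re = ‖(ψ : H)‖ ^ 2 := (norm_sq_eq_re_inner (𝕜 := ℂ) _).symm
  rw [h1] at h
  have h2 : ‖(ψ : H)‖ ^ 2 = 0 := by
    linarith [sq_nonneg ‖(ψ : H)‖, sq_nonneg ‖T ⟨ψ, adjointMulSelf_domain_le ψ.2⟩‖]
  have h3 : ψ = 0 := by simpa using h2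
  rw [h3]; simp

/-- `T* T` is self-adjoint when `T` is closed and densely defined. -/
theorem exists_adjointMulSelf_eq [CompleteSpace K] (hT : Dense (T.domain : Set H))
    (hc : T.IsClosed) {x z : H}
    (h : ∀ φ : (adjointMulSelf T).domain, inner ℂ x (adjointMulSelf T φ) = inner ℂ z (φ : H)) :
    ∃ hx : x ∈ (adjointMulSelf T).domain, adjointMulSelf T ⟨x, hx⟩ = z := by
  obtain ⟨ψ, hψ⟩ := exists_add_adjointMulSelf_eq hT hc (x + z)
  -- `x - ψ` is orthogonal to the range of `1 + T* T`, which is all of `H`.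
  have key : x - ψ = 0 := by
    obtain ⟨φ, hφ⟩ := exists_add_adjointMulSelf_eq hT hc (x - ψ)
    rw [← inner_self_eq_zero (𝕜 := ℂ)]
    nth_rewrite 2 [← hφ]
    rw [inner_add_right, inner_sub_left, inner_sub_left, h, ← inner_adjointMulSelf_symm hT]
    have : inner ℂ (x + z) (φ : H) = inner ℂ ((ψ : H) + adjointMulSelf T ψ) (φ : H) := by rw [hψ]
    rw [inner_add_left, inner_add_left] at this
    linear_combination this
  obtain rfl : x = ψ := sub_eq_zero.mp key
  exact ⟨ψ.2, add_left_cancel hψ⟩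

/-- A left inverse of `T* T` gives a lower bound for its quadratic form. -/
theorem norm_sq_le_of_leftInverse [CompleteSpace K] (hT : Dense (T.domain : Set H))
    (hc : T.IsClosed) {R : H →L[ℂ] H}
    (hR : ∀ ψ : (adjointMulSelf T).domain, R (adjointMulSelf T ψ) = ψ)
    (ψ : (adjointMulSelf T).domain) :
    ‖(ψ : H)‖ ^ 2 ≤ ‖R‖ * (inner ℂ (adjointMulSelf T ψ) (ψ : H)).re := by
  -- The preimage of `y` is `R* y`, since `⟨R* y, T* T φ⟩ = ⟨y, φ⟩` puts `R* y` in the domain by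
  -- self-adjointness.
  have hsurj : ∀ y, ∃ φ : (adjointMulSelf T).domain, adjointMulSelf T φ = y := fun y => by
    obtain ⟨hx, he⟩ := exists_adjointMulSelf_eq hT hc (x := R.adjoint y) (z := y) fun φ => by
      rw [ContinuousLinearMap.adjoint_inner_left, hR]
    exact ⟨_, he⟩
  have hpos : R.IsPositive := by
    refine ContinuousLinearMap.isPositive_def.mpr ⟨fun x y => ?_, fun x => ?_⟩
    · obtain ⟨φ, rfl⟩ := hsurj x
      obtain ⟨χ, rfl⟩ := hsurj y
      simp only [ContinuousLinearMap.coe_coe, hR]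
      exact (inner_adjointMulSelf_symm hT φ χ).symm
    · obtain ⟨φ, rfl⟩ := hsurj x
      rw [ContinuousLinearMap.reApplyInnerSelf_apply, hR, inner_re_symm]
      exact (sq_nonneg _).trans_eq (re_inner_adjointMulSelf_self hT φ).symm
  have h := hpos.norm_sq_apply_le (adjointMulSelf T ψ)
  rw [hR] at h
  rwa [← inner_adjointMulSelf_symm hT] at h

/-- If `T* T` is bounded below, it has a bounded left inverse. -/
theorem exists_leftInverse_of_norm_le [CompleteSpace K] (hT : Dense (T.domain : Set H))
    (hc : T.IsClosed) {C : ℝ}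
    (hC : ∀ ψ : (adjointMulSelf T).domain, ‖(ψ : H)‖ ≤ C * ‖adjointMulSelf T ψ‖) :
    ∃ R : H →L[ℂ] H, ∀ ψ : (adjointMulSelf T).domain, R (adjointMulSelf T ψ) = ψ := by
  -- A vector orthogonal to the range lies in the kernel by self-adjointness, hence vanishes by the
  -- lower bound. The inverse on the range then extends by continuity.
  have hd : DenseRange (adjointMulSelf T).toFun := by
    rw [DenseRange, ← LinearMap.coe_range, Submodule.dense_iff_topologicalClosure_eq_top,
      Submodule.topologicalClosure_eq_top_iff, Submodule.eq_bot_iff]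
    intro x hx
    obtain ⟨hx', he⟩ := exists_adjointMulSelf_eq hT hc (x := x) (z := 0) fun φ => by
      have h0 : inner ℂ (adjointMulSelf T φ) x = 0 := hx _ ⟨φ, rfl⟩
      rw [inner_zero_left, ← inner_conj_symm, h0, map_zero]
    have := hC ⟨x, hx'⟩
    rw [he, norm_zero, mul_zero] at this
    exact norm_le_zero_iff.mp this
  exact ⟨(adjointMulSelf T).domain.subtype.extendOfNorm (adjointMulSelf T).toFun,
    fun ψ => LinearMap.extendOfNorm_eq hd ⟨C, hC⟩ ψ⟩

end AdjointMulSelf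

end ThermalInterpretation
-- States and q-expectations
namespace ThermalInterpretation

section Trace

variable {H : Type u} [NormedAddCommGroup H] [InnerProductSpace ℂ H]

theorem hasTrace_rankOne (x y : H) :
    HasTrace (InnerProductSpace.rankOne ℂ x y) (inner ℂ y x) := by
  intro ι e
  simpa only [InnerProductSpace.rankOne_apply, inner_smul_right] using
    e.hasSum_inner_mul_inner y x

variable [CompleteSpace H]

/-- The density operator of a state is compact. -/
theorem State.isCompactOperator (ρ : State H) : IsCompactOperator ρ.density := by
  obtain ⟨w, b, -⟩ := exists_hilbertBasis ℂ H
  refine b.isCompactOperator_of_summable _ ρ.isPositive.isSymmetric ?_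
  have h := (RCLike.hasSum_re ℂ (ρ.hasTrace_one w b)).summable
  -- `‖ρ b‖² ≤ ‖ρ‖ ⟨b, ρ b⟩`, so finite trace makes `ρ` Hilbert–Schmidt.
  refine Summable.of_nonneg_of_le (fun _ => sq_nonneg _) (fun i => ?_) (h.mul_left ‖ρ.density‖)
  rw [inner_re_symm]
  exact ρ.isPositive.norm_sq_apply_le (b i)

/-- The pure state of a unit vector. -/
noncomputable def State.pure (u : H) (hu : ‖u‖ = 1) : State H where
  density := InnerProductSpace.rankOne ℂ u u
  isPositive := InnerProductSpace.isPositive_rankOne_self u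
  hasTrace_one := by
    have h := hasTrace_rankOne u u
    rwa [inner_self_eq_norm_sq_to_K, hu, RCLike.ofReal_one, one_pow] at h

variable {K : Type*} [NormedAddCommGroup K] [InnerProductSpace ℂ K] {T : H →ₗ.[ℂ] K}

/-- For the normalized vector `v` and its pure state, symmetry of `T* T` makes `ρ T* T` extend to
the rank-one operator `φ ↦ ⟨T* T v, φ⟩ v`, whose trace is the Rayleigh quotient. -/
theorem exists_state_hasQExpectation (hT : Dense (T.domain : Set H))
    (ψ : (adjointMulSelf T).domain) (hψ : (ψ : H) ≠ 0) :
    ∃ ρ : State H, ρ.HasQExpectation (adjointMulSelf T)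
      ((‖T ⟨ψ, adjointMulSelf_domain_le ψ.2⟩‖ ^ 2 / ‖(ψ : H)‖ ^ 2 : ℝ) : ℂ) := by
  have hn : ‖(ψ : H)‖ ≠ 0 := norm_ne_zero_iff.mpr hψ
  set c : ℂ := ((‖(ψ : H)‖⁻¹ : ℝ) : ℂ) with hc
  set v : (adjointMulSelf T).domain := c • ψ with hv
  have hv1 : ‖(v : H)‖ = 1 := by
    rw [hv, Submodule.coe_smul, norm_smul, hc, Complex.norm_real, norm_inv, norm_norm,
      inv_mul_cancel₀ hn]
  refine ⟨State.pure v hv1, InnerProductSpace.rankOne ℂ (v : H) (adjointMulSelf T v),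
    fun φ => ?_, ?_⟩
  · simp only [State.pure, InnerProductSpace.rankOne_apply]
    rw [inner_adjointMulSelf_symm hT]
  · have h := hasTrace_rankOne (v : H) (adjointMulSelf T v)
    rw [inner_adjointMulSelf hT v ⟨v, adjointMulSelf_domain_le v.2⟩,
      inner_self_eq_norm_sq_to_K] at h
    have hTv : T ⟨v, adjointMulSelf_domain_le v.2⟩ =
        c • T ⟨ψ, adjointMulSelf_domain_le ψ.2⟩ := T.map_smul c ⟨ψ, _⟩
    have hnv : ‖T ⟨v, adjointMulSelf_domain_le v.2⟩‖ =
        ‖(ψ : H)‖⁻¹ * ‖T ⟨ψ, adjointMulSelf_domain_le ψ.2⟩‖ := by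
      rw [hTv, norm_smul, hc, Complex.norm_real, norm_inv, norm_norm]
    convert h using 1
    rw [hnv, RCLike.ofReal_eq_complex_ofReal, ← Complex.ofReal_pow]
    congr 1
    field_simp

/-- If `T* T` has a bounded left inverse, its expectations are bounded away from zero. -/
theorem one_le_norm_mul_of_hasQExpectation [CompleteSpace K] (hT : Dense (T.domain : Set H))
    (hc : T.IsClosed) {R : H →L[ℂ] H}
    (hR : ∀ ψ : (adjointMulSelf T).domain, R (adjointMulSelf T ψ) = ψ) {ρ : State H} {t : ℝ}
    (h : ρ.HasQExpectation (adjointMulSelf T) (t : ℂ)) : 1 ≤ ‖R‖ * t := by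
  obtain ⟨A, hA, htr⟩ := h
  have hs : ∀ x y, inner ℂ (ρ.density x) y = inner ℂ x (ρ.density y) := ρ.isPositive.isSymmetric
  obtain ⟨ι, b, p, hp⟩ := ContinuousLinearMap.exists_hilbertBasis_eigenvectors
    ρ.isCompactOperator ρ.isPositive.isSymmetric
  have h1 := RCLike.hasSum_re ℂ (ρ.hasTrace_one ι b)
  have h2 := (RCLike.hasSum_re ℂ (htr ι b)).mul_left ‖R‖
  simp only [RCLike.re_to_complex, Complex.one_re, Complex.ofReal_re] at h1 h2
  -- The two traces are compared term by term in the eigenbasis of `ρ`.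
  refine hasSum_le (fun i => ?_) h1 h2
  have hbb : inner ℂ (b i) (b i) = (1 : ℂ) := by
    rw [inner_self_eq_norm_sq_to_K, b.orthonormal.1 i]; simp
  have hpi : inner ℂ (b i) (ρ.density (b i)) = p i := by
    rw [hp, inner_smul_right, hbb, mul_one]
  have hconj : (starRingEnd ℂ) (p i) = p i := by
    rw [← hpi, inner_conj_symm, hs]
  have hp0 : 0 ≤ (p i).re := by
    rw [← hpi]
    exact ρ.isPositive.re_inner_nonneg_right _
  have hAφ : ∀ φ : (adjointMulSelf T).domain,
      inner ℂ (b i) (A φ) = p i * inner ℂ (b i) (adjointMulSelf T φ) := fun φ => by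
    rw [hA, ← hs, hp, inner_smul_left, hconj]
  rw [hpi]
  rcases eq_or_ne (p i) 0 with h0 | h0
  · have hz : (fun x => inner ℂ (b i) (A x)) = fun _ => (0 : ℂ) := by
      refine Continuous.ext_on (dense_adjointMulSelf_domain hT hc) (by fun_prop) (by fun_prop) ?_
      intro x hx
      simpa [h0] using hAφ ⟨x, hx⟩
    rw [congrFun hz (b i), h0]
    simp
  -- Since `A` is bounded, so is `φ ↦ ⟨b i, T* T φ⟩`; self-adjointness then puts `b i` in the
  -- domain.
  · obtain ⟨hx, -⟩ := exists_adjointMulSelf_eq hT hc (x := b i)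
      (z := (p i)⁻¹ • A.adjoint (b i)) fun φ => by
        rw [inner_smul_left, map_inv₀, hconj, ContinuousLinearMap.adjoint_inner_left, hAφ,
          inv_mul_cancel_left₀ h0]
    have hb := hAφ ⟨b i, hx⟩
    have hlow := norm_sq_le_of_leftInverse hT hc hR ⟨b i, hx⟩
    rw [inner_adjointMulSelf_symm hT] at hlow
    rw [b.orthonormal.1 i, one_pow] at hlow
    have him : (p i).im = 0 := Complex.conj_eq_iff_im.mp hconj
    rw [hb, Complex.mul_re, him, zero_mul, sub_zero]
    calc (p i).re = (p i).re * 1 := (mul_one _).symm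
      _ ≤ (p i).re * (‖R‖ * _) := by gcongr
      _ = _ := by ring

end Trace

/-! ### Small Rayleigh quotients at spectral points -/

section Spectrum

variable {H : Type u} [NormedAddCommGroup H] [InnerProductSpace ℂ H] [CompleteSpace H]
  {K : Type*} [NormedAddCommGroup K] [InnerProductSpace ℂ K] [CompleteSpace K] {T : H →ₗ.[ℂ] K}

/-- Without a bounded left inverse, `T* T` has arbitrarily small Rayleigh quotients. -/
theorem exists_norm_sq_lt_of_not_leftInverse (hT : Dense (T.domain : Set H)) (hc : T.IsClosed)
    (hR : ¬ ∃ R : H →L[ℂ] H, ∀ ψ : (adjointMulSelf T).domain, R (adjointMulSelf T ψ) = ψ)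
    {ε : ℝ} (hε : 0 < ε) :
    ∃ ψ : (adjointMulSelf T).domain, (ψ : H) ≠ 0 ∧
      ‖T ⟨ψ, adjointMulSelf_domain_le ψ.2⟩‖ ^ 2 < ε * ‖(ψ : H)‖ ^ 2 := by
  by_contra! hcon
  -- A form bound `ε ‖ψ‖² ≤ ⟨T* T ψ, ψ⟩` becomes a norm bound with constant `ε⁻¹` by Cauchy–Schwarz.
  refine hR (exists_leftInverse_of_norm_le hT hc (C := ε⁻¹) fun ψ => ?_)
  rcases eq_or_ne (ψ : H) 0 with h0 | h0
  · rw [h0, norm_zero]; positivity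
  have h1 := hcon ψ h0
  rw [← re_inner_adjointMulSelf_self hT] at h1
  have h2 : (inner ℂ (adjointMulSelf T ψ) (ψ : H)).re ≤ ‖adjointMulSelf T ψ‖ * ‖(ψ : H)‖ :=
    re_inner_le_norm (𝕜 := ℂ) _ _
  have h3 : 0 < ‖(ψ : H)‖ := norm_pos_iff.mpr h0
  rw [le_inv_mul_iff₀ hε]
  refine le_of_mul_le_mul_right ?_ h3
  linarith [sq ‖(ψ : H)‖, mul_assoc ε ‖(ψ : H)‖ ‖(ψ : H)‖]

/-- The domain of `T* T` meets the complement of the kernel of a nonzero closed `T`. -/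
theorem exists_apply_ne_zero (hT : Dense (T.domain : Set H)) (hc : T.IsClosed)
    (h0 : ∃ x : T.domain, T x ≠ 0) :
    ∃ φ : (adjointMulSelf T).domain, T ⟨φ, adjointMulSelf_domain_le φ.2⟩ ≠ 0 := by
  obtain ⟨x, hx⟩ := h0
  by_contra! hcon
  -- If `T` killed the domain of `T* T`, then `T* T φ = 0`, so `x = φ` would be killed as well.
  obtain ⟨φ, hφ⟩ := exists_add_adjointMulSelf_eq hT hc (x : H)
  have hB : adjointMulSelf T φ = 0 := by
    refine hT.eq_zero_of_inner_left ℂ fun y hy => ?_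
    rw [inner_adjointMulSelf hT φ ⟨y, hy⟩, hcon, inner_zero_left]
  rw [hB, add_zero] at hφ
  refine hx ?_
  rw [← hcon φ]
  congr 1
  exact Subtype.ext hφ.symm

/-- If the vector `ψ` with small quotient lies in the kernel of `T`, replace it by `ψ + δ φ` with `T
φ ≠ 0`: the strict inequality survives for small `δ > 0`, while `T (ψ + δ φ) = δ T φ ≠ 0`. -/
theorem exists_pos_norm_sq_lt_of_not_leftInverse (hT : Dense (T.domain : Set H))
    (hc : T.IsClosed) (h0 : ∃ x : T.domain, T x ≠ 0)
    (hR : ¬ ∃ R : H →L[ℂ] H, ∀ ψ : (adjointMulSelf T).domain, R (adjointMulSelf T ψ) = ψ)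
    {ε : ℝ} (hε : 0 < ε) :
    ∃ ψ : (adjointMulSelf T).domain, T ⟨ψ, adjointMulSelf_domain_le ψ.2⟩ ≠ 0 ∧
      ‖T ⟨ψ, adjointMulSelf_domain_le ψ.2⟩‖ ^ 2 < ε * ‖(ψ : H)‖ ^ 2 := by
  obtain ⟨ψ, hψ, hlt⟩ := exists_norm_sq_lt_of_not_leftInverse hT hc hR hε
  by_cases hTψ : T ⟨ψ, adjointMulSelf_domain_le ψ.2⟩ = 0
  swap
  · exact ⟨ψ, hTψ, hlt⟩
  obtain ⟨φ, hφ⟩ := exists_apply_ne_zero hT hc h0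
  let L : (adjointMulSelf T).domain →ₗ[ℂ] K :=
    T.toFun ∘ₗ Submodule.inclusion adjointMulSelf_domain_le
  have hL : ∀ δ : ℝ, L (ψ + (δ : ℂ) • φ) = (δ : ℂ) • L φ := fun δ => by
    rw [map_add, map_smul, show L ψ = 0 from hTψ, zero_add]
  have hcont : Continuous fun δ : ℝ =>
      ε * ‖(ψ : H) + (δ : ℂ) • (φ : H)‖ ^ 2 - ‖(δ : ℂ) • L φ‖ ^ 2 := by fun_prop
  have hev : ∀ᶠ δ : ℝ in nhds 0,
      0 < ε * ‖(ψ : H) + (δ : ℂ) • (φ : H)‖ ^ 2 - ‖(δ : ℂ) • L φ‖ ^ 2 := by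
    refine hcont.continuousAt.eventually_const_lt ?_
    have hn : 0 < ‖(ψ : H)‖ := norm_pos_iff.mpr hψ
    simp only [Complex.ofReal_zero, zero_smul, add_zero, norm_zero]
    rw [zero_pow two_ne_zero, sub_zero]
    positivity
  obtain ⟨δ, hδ, hδ0⟩ :=
    ((hev.filter_mono nhdsWithin_le_nhds).and (self_mem_nhdsWithin (s := Set.Ioi (0 : ℝ)))).exists
  refine ⟨ψ + (δ : ℂ) • φ, ?_, ?_⟩
  · change L (ψ + (δ : ℂ) • φ) ≠ 0
    rw [hL]
    exact smul_ne_zero (Complex.ofReal_ne_zero.mpr (ne_of_gt hδ0)) hφ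
  · change ‖L (ψ + (δ : ℂ) • φ)‖ ^ 2 < _
    rw [hL]
    exact sub_pos.mp hδ

end Spectrum

/-! ### Closability of `X - ξ` -/

section Shift

variable {H : Type u} [NormedAddCommGroup H] [InnerProductSpace ℂ H] {m : ℕ}

/-- Subtracting a constant preserves closability. -/
theorem isClosable_vectorOperator_shift {D : Submodule ℂ H} {X : Fin m → D →ₗ[ℂ] H}
    (hX : (vectorOperator D X).IsClosable) (ξ : Fin m → ℂ) :
    (vectorOperator D (shift X ξ)).IsClosable := by
  obtain ⟨g, hg, hle⟩ := LinearPMap.isClosable_iff_exists_closed_extension.mp hX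
  let C : H →L[ℂ] PiLp 2 (fun _ : Fin m => H) :=
    (PiLp.continuousLinearEquiv 2 ℂ (fun _ : Fin m => H)).symm.toContinuousLinearMap ∘L
      ContinuousLinearMap.pi fun j => ξ j • ContinuousLinearMap.id ℂ H
  let g' : H →ₗ.[ℂ] PiLp 2 (fun _ : Fin m => H) :=
    ⟨g.domain, g.toFun - C.toLinearMap ∘ₗ g.domain.subtype⟩
  refine LinearPMap.isClosable_iff_exists_closed_extension.mpr ⟨g', ?_, hle.1, ?_⟩
  -- The graph of `g - C`, with `C` bounded, is the preimage of the closed graph of `g` under the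
  -- continuous shear `(x, y) ↦ (x, y + C x)`.
  · have : (g'.graph : Set (H × PiLp 2 (fun _ : Fin m => H))) =
        (fun z => (z.1, z.2 + C z.1)) ⁻¹' (g.graph : Set (H × PiLp 2 (fun _ : Fin m => H))) := by
      ext z
      simp only [SetLike.mem_coe, Set.mem_preimage, LinearPMap.mem_graph_iff]
      refine exists_congr fun y => and_congr_right fun hy => ?_
      change g y - C (y : H) = z.2 ↔ g y = z.2 + C z.1
      rw [hy, sub_eq_iff_eq_add]
    rw [LinearPMap.IsClosed, this]
    exact hg.preimage (by fun_prop)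
  · intro x y hxy
    have h := hle.2 hxy
    change _ = g y - C (y : H)
    rw [← h, ← hxy]
    rfl

end Shift

end ThermalInterpretation
-- The spectral criterion
/-- `X` is a vector quantity with `m` components on a common dense domain `D` of a complex Hilbert
space; closability says that the adjoint of `X` is densely defined. -/
theorem mainTheorem3 {H : Type u} [NormedAddCommGroup H] [InnerProductSpace ℂ H] [CompleteSpace H]
    {m : ℕ} (D : Submodule ℂ H) (hD : Dense (D : Set H)) (X : Fin m → D →ₗ[ℂ] H)
    (hX : (ThermalInterpretation.vectorOperator D X).IsClosable) (ξ : Fin m → ℂ) :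
    (ξ ∈ ThermalInterpretation.spec D X ↔
      ∀ ε : ℝ, 0 < ε → ∃ (ρ : ThermalInterpretation.State H) (t : ℝ),
        ρ.HasQExpectation
          (ThermalInterpretation.absSq D (ThermalInterpretation.shift X ξ)) (t : ℂ) ∧
        0 ≤ t ∧ t < ε) ∧
    ((∃ (j : Fin m) (ψ : D), X j ψ ≠ ξ j • (ψ : H)) →
      (ξ ∈ ThermalInterpretation.spec D X ↔
        ∀ ε : ℝ, 0 < ε → ∃ (ρ : ThermalInterpretation.State H) (t : ℝ),
          ρ.HasQExpectation
            (ThermalInterpretation.absSq D (ThermalInterpretation.shift X ξ)) (t : ℂ) ∧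
          0 < t ∧ t < ε)) := by
  open ThermalInterpretation in
  set Y := vectorOperator D (shift X ξ)
  have hc : Y.closure.IsClosed := (isClosable_vectorOperator_shift hX ξ).closure_isClosed
  have hT : Dense (Y.closure.domain : Set H) := hD.mono Y.le_closure.1
  have back : (∀ ε : ℝ, 0 < ε → ∃ (ρ : State H) (t : ℝ),
      ρ.HasQExpectation (absSq D (shift X ξ)) (t : ℂ) ∧ 0 ≤ t ∧ t < ε) → ξ ∈ spec D X := by
    rintro h ⟨R, hR⟩
    -- Adding `1` keeps the bound positive even for `R = 0`.
    obtain ⟨ρ, t, hρ, ht0, ht⟩ := h (‖R‖ + 1)⁻¹ (by positivity)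
    have h1 := one_le_norm_mul_of_hasQExpectation hT hc hR hρ
    have h2 : (‖R‖ + 1) * t < 1 := by
      rwa [← lt_inv_mul_iff₀ (by positivity), mul_one]
    linarith
  refine ⟨⟨fun h ε hε => ?_, back⟩, fun hne => ⟨fun h ε hε => ?_, fun h => back fun ε hε => ?_⟩⟩
  · obtain ⟨ψ, hψ, hlt⟩ := exists_norm_sq_lt_of_not_leftInverse hT hc h hε
    obtain ⟨ρ, hρ⟩ := exists_state_hasQExpectation hT ψ hψ
    have hn : 0 < ‖(ψ : H)‖ := norm_pos_iff.mpr hψ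
    exact ⟨ρ, _, hρ, by positivity, (div_lt_iff₀ (by positivity)).mpr hlt⟩
  · have h0 : ∃ x : Y.closure.domain, Y.closure x ≠ 0 := by
      obtain ⟨j, ψ, hjψ⟩ := hne
      refine ⟨⟨ψ, Y.le_closure.1 ψ.2⟩, fun h0 => hjψ (sub_eq_zero.mp ?_)⟩
      have h1 : Y ψ = 0 := (Y.le_closure.2 (x := ψ) (y := ⟨ψ, Y.le_closure.1 ψ.2⟩) rfl).trans h0
      exact congrArg (fun v : PiLp 2 (fun _ : Fin m => H) => v j) h1
    obtain ⟨ψ, hψ, hlt⟩ := exists_pos_norm_sq_lt_of_not_leftInverse hT hc h0 h hε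
    have hψ0 : (ψ : H) ≠ 0 := fun h0 =>
      hψ ((congrArg Y.closure (Subtype.ext h0)).trans Y.closure.map_zero)
    obtain ⟨ρ, hρ⟩ := exists_state_hasQExpectation hT ψ hψ0
    have hn : 0 < ‖(ψ : H)‖ := norm_pos_iff.mpr hψ0
    have hn' := norm_pos_iff.mpr hψ
    exact ⟨ρ, _, hρ, by positivity, (div_lt_iff₀ (by positivity)).mpr hlt⟩
  · obtain ⟨ρ, t, hρ, ht0, ht⟩ := h ε hε
    exact ⟨ρ, t, hρ, ht0.le, ht⟩
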